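/- **Setting.** Let $\sigma:\mathbb{R}\to\mathbb{R}$ be continuous and not a polynomial. An MLP is a feed-forward network with at least one hidden layer (arbitrary widths and depth), activation $\sigma$ on the hidden layers and an affine output layer. A $k$-layer GNN is a composition of $k$ layers $$h_v^{(\ell)} = f_1^{(\ell)}\Big(h_v^{(\ell-1)},\ \sum_{u\in\mathcal N_v} f_2^{(\ell)}\big(h_v^{(\ell-1)},h_u^{(\ell-1)}\big)\Big),$$ with $f_1^{(\ell)},f_2^{(\ell)}$ MLPs, $\mathcal N_v$ the set of neighbours of $v$, and $h_v^{(0)}$ the feature vector of $v$. Graphs are finite, simple and undirected, with node features in $\mathbb{R}^d$. For a GNN $M$ with $L'$ layers and $L<L'$, the shaDow-GNN $M_L$ with $L$-hop extraction maps a node $v$ of $G$ to the embedding of $v$ obtained by running $M$ on the connected subgraph of $G$ induced on all nodes at distance at most $L$ from $v$, with all other nodes and edges ignored. The 1-WL colours are $c^0(v)=$ the feature vector of $v$ and $c^{t+1}(v)=\big(c^t(v),\{\!\{c^t(u):u\in\mathcal N_v\}\!\}\big)$; 1-WL separates two nodes (of the same graph or of two graphs) within $L$ iterations if their colours differ for some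 $t\le L$. **Theorem 3.** shaDow-GNNs with more layers than hops are strictly more discriminative than the 1-WL test, in the following sense. (i) For all $d,\Delta,L,L'\in\mathbb{N}$ with $L<L'$ and every finite set $X\subset\mathbb{R}^d$ there is a GNN $M$ with $L'$ layers such that: * (at least as discriminative) for all graphs $G,H$ with maximum degree at most $\Delta$ and all node features in $X$, and all nodes $a$ of $G$ and $b$ of $H$, if 1-WL separates $a$ and $b$ within $L$ iterations, then $M_L$ gives $a$ and $b$ different embeddings; * (strictly more) if $L\ge 1$, there are a graph and two of its nodes $a,b$ such that, for every $c\in X$, when all nodes have the feature $c$, the 1-WL colours of $a$ and $b$ agree after every number of iterations, while $M_L$ gives $a$ and $b$ different embeddings; * if $L=1$ (so $L'\geq 2$), then for every $c\in X$, when all nodes have the feature $c$, $M_1$ gives the nodes $1$ and $3$ of the following graph different embeddings: the 8-cycle $0,1,\dots,7$ with the additional edges $\{1,5\},\{0,2\},\{4,7\},\{3,6\}$. (ii) This last graph is connected and 3-regular, and when all its nodes have the same feature, the 1-WL colours of the nodes $1$ and $3$ agree after every number of iterations. -/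

import Mathlib

/-!  Multilayer perceptrons, message-passing GNNs, colour refinement and subgraph scopes.  -/

universe u w

/-- The weights of a multilayer perceptron with `m` inputs and `n` outputs:
at least one hidden layer, arbitrary widths and depth, affine output layer. -/
inductive MLP : ℕ → ℕ → Type
  | shallow {m h n : ℕ} (A : Matrix (Fin h) (Fin m) ℝ) (a : Fin h → ℝ)
      (B : Matrix (Fin n) (Fin h) ℝ) (b : Fin n → ℝ) : MLP m n
  | deep {m h n : ℕ} (A : Matrix (Fin h) (Fin m) ℝ) (a : Fin h → ℝ) (rest : MLP h n) : MLP m n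

/-- The function computed by a multilayer perceptron with activation `σ`. -/
noncomputable def MLP.eval (σ : ℝ → ℝ) : {m n : ℕ} → MLP m n → (Fin m → ℝ) → (Fin n → ℝ)
  | _, _, .shallow A a B b, x => B.mulVec (fun i => σ (A.mulVec x i + a i)) + b
  | _, _, .deep A a rest, x => rest.eval σ (fun i => σ (A.mulVec x i + a i))

/-- An undirected graph on `V` whose nodes carry feature vectors in `ℝ ^ d`. -/
structure AttrGraph (V : Type u) (d : ℕ) where
  graph : SimpleGraph V
  feat : V → (Fin d → ℝ)

/-- One message-passing layer: the update perceptron and the message perceptron. -/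
structure GNNLayer (d e : ℕ) where
  {msgDim : ℕ}
  update : MLP (d + msgDim) e
  message : MLP (d + d) msgDim

open Classical in
/-- `h'_v = f₁ (h_v, ∑ u ∈ N_v, f₂ (h_v, h_u))`. -/
noncomputable def GNNLayer.apply (σ : ℝ → ℝ) {d e : ℕ} (ly : GNNLayer d e)
    {V : Type u} [Fintype V] (G : SimpleGraph V) (h : V → (Fin d → ℝ)) (v : V) : Fin e → ℝ :=
  ly.update.eval σ (Fin.append (h v)
    (∑ x ∈ Finset.univ.filter (fun x => G.Adj v x),
      ly.message.eval σ (Fin.append (h v) (h x))))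

/-- `GNN k d e`: a GNN with exactly `k` layers, `d` input channels and `e` output channels. -/
inductive GNN : ℕ → ℕ → ℕ → Type
  | nil {d : ℕ} : GNN 0 d d
  | cons {k d e f : ℕ} (first : GNNLayer d e) (rest : GNN k e f) : GNN (k + 1) d f

/-- The output embeddings of all nodes, starting from the node embeddings `h`. -/
noncomputable def GNN.run (σ : ℝ → ℝ) {V : Type u} [Fintype V] (G : SimpleGraph V) :
    {k d e : ℕ} → GNN k d e → (V → (Fin d → ℝ)) → (V → (Fin e → ℝ))
  | _, _, _, .nil, h => h
  | _, _, _, .cons first rest, h => rest.run σ G (first.apply σ G h)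

/-- Colours of 1-WL after `t` iterations, for initial colours in `α`.  The colour of the next
iteration is the pair (own colour, multiset of the neighbours' colours), so that the relabelling is
injective and colours are comparable across graphs. -/
def WLColor (α : Type) : ℕ → Type
  | 0 => α
  | t + 1 => WLColor α t × Multiset (WLColor α t)

open Classical in
/-- The colour of a node after `t` iterations of 1-WL, starting from the node features. -/
noncomputable def wl {V : Type u} [Fintype V] {d : ℕ} (G : AttrGraph V d) :
    (t : ℕ) → V → WLColor (Fin d → ℝ) t
  | 0, v => G.feat v
  | t + 1, v =>
    (wl G t v, (Finset.univ.filter (fun x => G.graph.Adj v x)).val.map (wl G t))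

/-- A subgraph, regarded as a graph of its own, with the inherited features. -/
def AttrGraph.restrict {V : Type u} {d : ℕ} (G : AttrGraph V d) (S : G.graph.Subgraph) :
    AttrGraph S.verts d where
  graph := S.coe
  feat := fun x => G.feat x

/-- A subgraph extraction function on `G`: to every target node `v` it assigns a connected subgraph
that contains `v` and has depth at most `L` as seen from `v`. -/
structure Extractor {V : Type u} (L : ℕ) (G : SimpleGraph V) where
  scope : V → G.Subgraph
  mem : ∀ v, v ∈ (scope v).verts
  connected : ∀ v, (scope v).Connected
  depth_le : ∀ v (x : (scope v).verts), (scope v).coe.dist ⟨v, mem v⟩ x ≤ L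

open Classical in
/-- The embedding of the target node `v` computed by the decoupled GNN: run `M` on the scope of
`v` as if it were the full graph, and read off the embedding of `v`. -/
noncomputable def shadow (σ : ℝ → ℝ) {k d e L : ℕ} (M : GNN k d e) {V : Type u} [Fintype V]
    (G : AttrGraph V d) (E : Extractor L G.graph) (v : V) : Fin e → ℝ :=
  M.run σ (G.restrict (E.scope v)).graph (G.restrict (E.scope v)).feat ⟨v, E.mem v⟩

/-- The subgraph induced on all nodes at distance at most `L` from `v`. -/
def hopSubgraph {V : Type u} (G : SimpleGraph V) (L : ℕ) (v : V) : G.Subgraph :=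
  (⊤ : G.Subgraph).induce {x | G.edist v x ≤ L}

theorem hopSubgraph_walk {V : Type u} (G : SimpleGraph V) (L : ℕ) (v : V)
    (hv : v ∈ (hopSubgraph G L v).verts) (x : (hopSubgraph G L v).verts) :
    ∃ p : (hopSubgraph G L v).coe.Walk ⟨v, hv⟩ x, p.length ≤ L := by
  suffices H : ∀ (k : ℕ) (y : V) (q : G.Walk y v), q.length = k → k ≤ L →
      ∀ hy : y ∈ (hopSubgraph G L v).verts,
        ∃ p : (hopSubgraph G L v).coe.Walk ⟨v, hv⟩ ⟨y, hy⟩, p.length = k by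
    have hx : G.edist v x.1 ≤ L := x.2
    have hne : G.edist v x.1 ≠ ⊤ := fun h => by simp [h] at hx
    obtain ⟨q, hq⟩ := SimpleGraph.exists_walk_of_edist_ne_top hne
    have hL : q.length ≤ L := by
      rw [← hq] at hx
      exact_mod_cast hx
    obtain ⟨p, hp⟩ := H q.length x.1 q.reverse (by simp) hL x.2
    exact ⟨p, hp.trans_le hL⟩
  intro k
  induction k with
  | zero =>
    intro y q hq _ hy
    obtain rfl := SimpleGraph.Walk.eq_of_length_eq_zero hq
    exact ⟨.nil, rfl⟩
  | succ k ih =>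
    intro y q hq hk hy
    match q, hq with
    | .cons (v := z) hadj q', hq =>
      have hlen : q'.length = k := by simpa using hq
      have hz : z ∈ (hopSubgraph G L v).verts := by
        change G.edist v z ≤ L
        rw [SimpleGraph.edist_comm]
        refine (SimpleGraph.edist_le q').trans ?_
        exact_mod_cast (by omega : q'.length ≤ L)
      obtain ⟨p, hp⟩ := ih z q' hlen (by omega) hz
      have hzy : (hopSubgraph G L v).coe.Adj ⟨z, hz⟩ ⟨y, hy⟩ := ⟨hz, hy, hadj.symm⟩
      exact ⟨p.concat hzy, by simp [hp]⟩

theorem hopSubgraph_mem {V : Type u} (G : SimpleGraph V) (L : ℕ) (v : V) :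
    v ∈ (hopSubgraph G L v).verts := by
  change G.edist v v ≤ L
  simp

/-- `L`-hop extraction: the subgraph induced on the full `L`-hop neighbourhood. -/
def hopExtractor {V : Type u} (L : ℕ) (G : SimpleGraph V) : Extractor L G where
  scope := hopSubgraph G L
  mem := hopSubgraph_mem G L
  connected v := by
    refine ⟨?_⟩
    refine (SimpleGraph.connected_iff_exists_forall_reachable _).2
      ⟨⟨v, hopSubgraph_mem G L v⟩, fun x => ?_⟩
    obtain ⟨p, -⟩ := hopSubgraph_walk G L v (hopSubgraph_mem G L v) x
    exact ⟨p⟩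
  depth_le v x := by
    obtain ⟨p, hp⟩ := hopSubgraph_walk G L v (hopSubgraph_mem G L v) x
    exact (SimpleGraph.dist_le p).trans hp

/-- An 8-cycle with the four chords `1-5`, `0-2`, `4-7`, `3-6`. -/
def chordedOctagon : SimpleGraph (Fin 8) :=
  SimpleGraph.cycleGraph 8 ⊔ SimpleGraph.fromEdgeSet {s(1, 5), s(0, 2), s(4, 7), s(3, 6)}

/-- The graph `G` with the same feature vector `c` at every node. -/
def AttrGraph.const {V : Type u} {d : ℕ} (G : SimpleGraph V) (c : Fin d → ℝ) : AttrGraph V d where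
  graph := G
  feat := fun _ => c

/-!
A perceptron with a continuous, non-polynomial activation `σ` interpolates any function exactly on
a finite set of points (`MLP.exists_eqOn`). Indeed, a linear relation between the values of all ridge
functions `x ↦ σ (w ⬝ᵥ x + b)` at finitely many points would, after differences that remove one
point at a time, make a fixed iterated difference of `σ` vanish identically, and then `σ` would be a
polynomial by Fréchet's theorem (`exists_polynomial_of_fwdDiff_iter_eq_zero`).

For features in a finite set and bounded degree, only finitely many pairs of a state and a multiset
of neighbouring states occur at each layer, so every layer can be made injective on these pairs
(`GNNLayer.exists_faithful`). A network of such layers is at least as discriminative as 1-WL with as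
many iterations as there are layers (`GNN.Faithful.wl_eq_of_run_eq`). It remains to look at 1-WL on
the `L`-hop neighbourhoods:

* for the first `L` iterations, the root has the same colour in its neighbourhood as in the whole
  graph (`wl_restrict_hopSubgraph`), so nothing that 1-WL separates is lost;
* iteration `L + 1` sees the degrees, within the neighbourhood, of the nodes at distance `L` from
  the root. In a regular graph, where 1-WL gives all nodes the same colour, these degrees reveal
  whether the graph continues beyond the neighbourhood
  (`wl_restrict_hopSubgraph_ne_of_regular`). A triangle and a long cycle are such an example for all
  `L ≥ 1`, and for the chorded octagon the degrees reveal the triangle at the node `1`.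
-/

/-! ### Exact interpolation by perceptrons -/

open Polynomial in
/-- Fréchet's theorem: a continuous function whose `n`-th differences all vanish is a polynomial.
On each arithmetic progression Newton's formula gives a polynomial of degree less than `n`, and
progressions that share `n` points give the same one, so `f` is a single polynomial on `ℚ`. -/
theorem exists_polynomial_of_fwdDiff_iter_eq_zero {f : ℝ → ℝ} (hf : Continuous f) (n : ℕ)
    (h0 : ∀ h x, (fwdDiff h)^[n] f x = 0) : ∃ p : ℝ[X], ∀ x, f x = p.eval x := by
  -- along every arithmetic progression, `f` is a polynomial of degree less than `n`
  have key : ∀ y h : ℝ, ∃ q : ℝ[X], q.degree < n ∧ ∀ k : ℕ, f (y + k * h) = q.eval (k : ℝ) := by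
    intro y h
    have hz : ∀ j, n ≤ j → ∀ x, (fwdDiff h)^[j] f x = 0 := by
      intro j hj
      induction j, hj using Nat.le_induction with
      | base => exact h0 h
      | succ j _ ih => intro x; rw [Function.iterate_succ_apply']; simp [fwdDiff, ih]
    refine ⟨∑ j ∈ Finset.range n,
      C ((fwdDiff h)^[j] f y / (j.factorial : ℝ)) * descPochhammer ℝ j, ?_, fun k => ?_⟩
    · refine (degree_sum_le _ _).trans_lt ((Finset.sup_lt_iff (WithBot.bot_lt_coe n)).2 ?_)
      intro j hj
      have : (descPochhammer ℝ j).degree ≤ j :=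
        degree_le_of_natDegree_le (descPochhammer_natDegree ℝ j).le
      rw [← smul_eq_C_mul]
      exact (degree_smul_le _ _).trans_lt
        (this.trans_lt (Nat.cast_lt.2 (Finset.mem_range.1 hj)))
    · have h1 := shift_eq_sum_fwdDiff_iter h f k y
      rw [nsmul_eq_mul] at h1
      rw [h1, eval_finsetSum]
      have h2 : ∑ j ∈ Finset.range (k + 1), k.choose j • (fwdDiff h)^[j] f y
          = ∑ j ∈ Finset.range (max (k + 1) n), k.choose j • (fwdDiff h)^[j] f y := by
        refine Finset.sum_subset (Finset.range_subset_range.2 (le_max_left _ _)) ?_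
        intro j _ hj
        rw [Nat.choose_eq_zero_of_lt (by simpa using hj), zero_smul]
      have h3 : ∑ j ∈ Finset.range n, k.choose j • (fwdDiff h)^[j] f y
          = ∑ j ∈ Finset.range (max (k + 1) n), k.choose j • (fwdDiff h)^[j] f y := by
        refine Finset.sum_subset (Finset.range_subset_range.2 (le_max_right _ _)) ?_
        intro j _ hj
        rw [hz j (by simpa using hj), smul_zero]
      rw [h2, ← h3]
      refine Finset.sum_congr rfl fun j _ => ?_
      rw [eval_mul, eval_C, descPochhammer_eval_eq_descFactorial, nsmul_eq_mul,
        Nat.descFactorial_eq_factorial_mul_choose]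
      have : (j.factorial : ℝ) ≠ 0 := by positivity
      push_cast
      field_simp
  obtain ⟨p, hpd, hp⟩ := key 0 1
  refine ⟨p, fun x => ?_⟩
  refine congrFun (DenseRange.equalizer Rat.isDenseEmbedding_coe_real.dense hf p.continuous
    (funext fun r => ?_)) x
  -- compare the polynomials of the progressions `0, 1, 2, …` and `-K, -K + 1 / N, -K + 2 / N, …`
  obtain ⟨N, hN, a, ha⟩ : ∃ N : ℕ, 0 < N ∧ ∃ a : ℤ, (r : ℝ) = a / N :=
    ⟨r.den, r.den_pos, r.num, by exact_mod_cast (Rat.num_div_den r).symm⟩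
  have hN' : (N : ℝ) ≠ 0 := by positivity
  set K := a.natAbs with hK
  obtain ⟨q, hqd, hq⟩ := key (-K) (1 / N)
  have hpq : q = p.comp (C (1 / (N : ℝ)) * X + C (-(K : ℝ))) := by
    have hinj : Set.InjOn (fun j : ℕ => ((K * N + j * N : ℕ) : ℝ)) (Finset.range n) := by
      intro i _ j _ hij
      have : K * N + i * N = K * N + j * N := Nat.cast_injective (R := ℝ) hij
      exact Nat.eq_of_mul_eq_mul_right hN (by omega)
    refine eq_of_degrees_lt_of_eval_index_eq (Finset.range n) hinj (by simpa using hqd) ?_ ?_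
    · rw [Finset.card_range]
      rcases eq_or_ne p 0 with rfl | hp0
      · simp
      · refine (degree_le_natDegree).trans_lt ?_
        rw [natDegree_comp, natDegree_linear (by positivity), mul_one, ← degree_eq_natDegree hp0]
        exact hpd
    · intro j _
      have e1 := hq (K * N + j * N)
      have e2 := hp j
      rw [← e1]
      simp only [eval_comp, eval_add, eval_mul, eval_C, eval_X]
      have : -(K : ℝ) + ((K * N + j * N : ℕ) : ℝ) * (1 / N) = j := by
        push_cast; field_simp; ring
      rw [this, mul_comm (1 / (N : ℝ)), add_comm _ (-(K : ℝ)), this, ← e2]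
      simp
  obtain ⟨k, hk⟩ : ∃ k : ℕ, (k : ℤ) = a + K * N := by
    refine ⟨(a + K * N).toNat, Int.toNat_of_nonneg ?_⟩
    have h1 : (K : ℤ) * 1 ≤ K * N := by gcongr; exact_mod_cast hN
    omega
  have hk' : (k : ℝ) = a + K * N := by exact_mod_cast hk
  have e : -(K : ℝ) + k * (1 / N) = r := by rw [hk', ha]; field_simp; ring
  have h1 := hq k
  rw [hpq, e] at h1
  simp only [eval_comp, eval_add, eval_mul, eval_C, eval_X] at h1
  rw [mul_comm (1 / (N : ℝ)), add_comm _ (-(K : ℝ)), e] at h1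
  exact h1

/-- Each term `F i ∘ ℓ i` of the relation is killed by a difference in a direction in the kernel of
`ℓ i`. Such a direction can be chosen to raise `ℓ₀` by `h`, so what remains after all terms are
killed is an iterated difference of `F₀`. -/
theorem fwdDiff_iter_eq_zero_of_sum_comp_eq_zero {E ι : Type*} [AddCommGroup E] [Module ℝ E]
    [DecidableEq ι]
    (ℓ : ι → E →ₗ[ℝ] ℝ) (ℓ₀ : E →ₗ[ℝ] ℝ) (p₀ : E) (hp₀ : ℓ₀ p₀ = 1) (h : ℝ) (A : Finset ι) :
    (∀ i ∈ A, ∃ p, ℓ i p = 0 ∧ ℓ₀ p = 1) → ∀ (F₀ : ℝ → ℝ) (F : ι → ℝ → ℝ),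
      (∀ p, F₀ (ℓ₀ p) + ∑ i ∈ A, F i (ℓ i p) = 0) → ∀ x, (fwdDiff h)^[A.card] F₀ x = 0 := by
  induction A using Finset.induction_on with
  | empty =>
    intro _ F₀ F hF x
    simpa [hp₀] using hF (x • p₀)
  | insert j A hj ih =>
    intro hA F₀ F hF x
    obtain ⟨q, hq, hq₀⟩ := hA j (Finset.mem_insert_self _ _)
    rw [Finset.card_insert_of_notMem hj, Function.iterate_succ_apply]
    refine ih (fun i hi => hA i (Finset.mem_insert_of_mem hi)) _
      (fun i => fwdDiff (ℓ i (h • q)) (F i)) (fun p => ?_) x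
    have h1 := hF (p + h • q)
    have h2 := hF p
    rw [Finset.sum_insert hj] at h1 h2
    simp only [map_add, map_smul, hq, hq₀, smul_eq_mul, mul_one, mul_zero, add_zero] at h1
    simp only [fwdDiff, map_smul, smul_eq_mul, Finset.sum_sub_distrib]
    linarith

/-- The functions `x ↦ σ (w ⬝ᵥ x + b)` span all functions on a finite set of points. -/
theorem span_ridge_eq_top {σ : ℝ → ℝ} (hσ : Continuous σ)
    (hσ' : ¬ ∃ p : Polynomial ℝ, ∀ x, σ x = p.eval x) {m : ℕ} (T : Finset (Fin m → ℝ)) :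
    Submodule.span ℝ (Set.range fun (p : (Fin m → ℝ) × ℝ) (x : T) => σ (p.1 ⬝ᵥ x + p.2)) = ⊤ := by
  classical
  by_contra hne
  obtain ⟨f, hf, hker⟩ := Submodule.exists_le_ker_of_lt_top _ (lt_top_iff_ne_top.2 hne)
  have hrel : ∀ p : (Fin m → ℝ) × ℝ,
      ∑ x : T, f (Pi.single x 1) * σ (p.1 ⬝ᵥ x + p.2) = 0 := by
    intro p
    have h1 := hker (Submodule.subset_span ⟨p, rfl⟩)
    rw [LinearMap.mem_ker, LinearMap.pi_apply_eq_sum_univ f] at h1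
    rw [← h1]
    refine Finset.sum_congr rfl fun x _ => ?_
    rw [smul_eq_mul, mul_comm]
    congr 2
    ext y
    simp [Pi.single_apply, eq_comm]
  -- a functional that vanishes on the span is a relation between the values at the points;
  -- solving it for the point `x₀` bounds the degree of `σ`
  obtain ⟨x₀, hx₀⟩ : ∃ x₀ : T, f (Pi.single x₀ 1) ≠ 0 := by
    by_contra! hall
    refine hf (LinearMap.pi_ext' fun x => LinearMap.ext_ring ?_)
    simpa using hall x
  let ℓ : T → (Fin m → ℝ) × ℝ →ₗ[ℝ] ℝ := fun x =>
    { toFun := fun p => p.1 ⬝ᵥ x + p.2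
      map_add' := fun p q => by simp [add_dotProduct]; ring
      map_smul' := fun c p => by simp [smul_dotProduct]; ring }
  refine hσ' (exists_polynomial_of_fwdDiff_iter_eq_zero hσ (Finset.univ.erase x₀).card fun h x => ?_)
  refine fwdDiff_iter_eq_zero_of_sum_comp_eq_zero ℓ (ℓ x₀) (0, 1) (by simp [ℓ]) h
    (Finset.univ.erase x₀) ?_ σ (fun i t => f (Pi.single i 1) / f (Pi.single x₀ 1) * σ t) ?_ x
  · intro y hy
    have hxy : (x₀ : Fin m → ℝ) - (y : Fin m → ℝ) ≠ 0 :=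
      sub_ne_zero.2 fun h => (Finset.mem_erase.1 hy).1 (Subtype.ext h.symm)
    set v := (x₀ : Fin m → ℝ) - (y : Fin m → ℝ) with hv
    have hpos : v ⬝ᵥ v ≠ 0 := fun h => hxy (dotProduct_self_eq_zero.1 h)
    -- moving `w` along `x₀ - y` changes the value at `x₀`; the bias compensates at `y`
    refine ⟨(v ⬝ᵥ v)⁻¹ • (v, -(v ⬝ᵥ y)), ?_, ?_⟩
    · rw [map_smul]; simp [ℓ]
    · have : ℓ x₀ (v, -(v ⬝ᵥ y)) = v ⬝ᵥ v := by
        conv_rhs => rw [hv, dotProduct_sub, ← hv]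
        simp [ℓ]; ring
      rw [map_smul, this, smul_eq_mul, inv_mul_cancel₀ hpos]
  · intro p
    have h1 := hrel p
    rw [← Finset.add_sum_erase _ _ (Finset.mem_univ x₀)] at h1
    have h2 : σ (ℓ x₀ p) + ∑ i ∈ Finset.univ.erase x₀,
        f (Pi.single i 1) / f (Pi.single x₀ 1) * σ (ℓ i p) = (f (Pi.single x₀ 1))⁻¹ *
        (f (Pi.single x₀ 1) * σ (p.1 ⬝ᵥ x₀ + p.2) + ∑ i ∈ Finset.univ.erase x₀,
        f (Pi.single i 1) * σ (p.1 ⬝ᵥ i + p.2)) := by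
      rw [mul_add, inv_mul_cancel_left₀ hx₀, Finset.mul_sum]
      congr 1
      refine Finset.sum_congr rfl fun i _ => ?_
      simp only [ℓ, LinearMap.coe_mk, AddHom.coe_mk]
      ring
    rw [h2, h1, mul_zero]

/-- Perceptrons with one hidden layer interpolate exactly on finite sets. -/
theorem MLP.exists_eqOn {σ : ℝ → ℝ} (hσ : Continuous σ)
    (hσ' : ¬ ∃ p : Polynomial ℝ, ∀ x, σ x = p.eval x) {m n : ℕ} {T : Set (Fin m → ℝ)}
    (hT : T.Finite) (g : (Fin m → ℝ) → (Fin n → ℝ)) :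
    ∃ N : MLP m n, Set.EqOn (N.eval σ) g T := by
  classical
  lift T to Finset (Fin m → ℝ) using hT
  have hmem : ∀ j : Fin n, ∃ c : ((Fin m → ℝ) × ℝ) →₀ ℝ,
      (c.sum fun p r => r • fun x : T => σ (p.1 ⬝ᵥ x + p.2)) = fun x : T => g x j := by
    intro j
    refine Finsupp.mem_span_range_iff_exists_finsupp.1 ?_
    rw [span_ridge_eq_top hσ hσ']
    trivial
  choose c hc using hmem
  -- one hidden unit for each ridge function that occurs in some coordinate
  let U : Finset ((Fin m → ℝ) × ℝ) := Finset.univ.biUnion fun j => (c j).support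
  let w : Fin U.card → (Fin m → ℝ) × ℝ := fun i => U.equivFin.symm i
  refine ⟨.shallow (Matrix.of fun i => (w i).1) (fun i => (w i).2)
    (Matrix.of fun j i => c j (w i)) 0, fun x hx => ?_⟩
  ext j
  have h1 := congrFun (hc j) ⟨x, hx⟩
  rw [Finsupp.sum_of_support_subset (s := U) _
    (Finset.subset_biUnion_of_mem (fun j => (c j).support) (Finset.mem_univ j)) _ (by simp)] at h1
  rw [← h1]
  simp only [MLP.eval, add_zero, Matrix.mulVec, dotProduct, Matrix.of_apply, Finset.sum_apply,
    Pi.smul_apply, smul_eq_mul]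
  rw [← Finset.sum_coe_sort U]
  exact Equiv.sum_comp U.equivFin.symm
    (fun p : U => c j p * σ (∑ i, p.1.1 i * x i + p.1.2))

/-! ### Faithful layers and networks -/

/-- The update of one layer as a function of a node's own state and the multiset of the states of
its neighbours. -/
noncomputable def GNNLayer.step (σ : ℝ → ℝ) {d e : ℕ} (ly : GNNLayer d e) (c : Fin d → ℝ)
    (s : Multiset (Fin d → ℝ)) : Fin e → ℝ :=
  ly.update.eval σ (Fin.append c (s.map fun x => ly.message.eval σ (Fin.append c x)).sum)

open Classical in
theorem GNNLayer.apply_eq_step (σ : ℝ → ℝ) {d e : ℕ} (ly : GNNLayer d e) {V : Type u} [Fintype V]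
    (G : SimpleGraph V) (h : V → (Fin d → ℝ)) (v : V) :
    ly.apply σ G h v = ly.step σ (h v) ((Finset.univ.filter (fun x => G.Adj v x)).val.map h) := by
  simp [GNNLayer.apply, GNNLayer.step, Finset.sum]

/-- The multisets of at most `Δ` elements of `C`: the possible neighbourhoods of a node of degree
at most `Δ` in a graph whose node states lie in `C`. -/
def boundedMultisets {α : Type*} (C : Set α) (Δ : ℕ) : Set (Multiset α) :=
  {s | (∀ x ∈ s, x ∈ C) ∧ s.card ≤ Δ}

theorem finite_boundedMultisets {α : Type*} {C : Set α} (hC : C.Finite) (Δ : ℕ) :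
    (boundedMultisets C Δ).Finite := by
  classical
  refine (Set.finite_Iic (Δ • hC.toFinset.val)).subset fun s hs => ?_
  refine Multiset.le_iff_count.2 fun x => ?_
  by_cases hx : x ∈ s
  · rw [Multiset.count_nsmul, Multiset.count_eq_one_of_mem hC.toFinset.nodup
      (by simpa using hs.1 x hx), mul_one]
    exact (Multiset.count_le_card x s).trans hs.2
  · simp [Multiset.count_eq_zero_of_notMem hx]

/-- A layer is faithful if it is injective on pairs of a state in `C` and a neighbourhood of at most
`Δ` states in `C`. -/
def GNNLayer.Faithful (σ : ℝ → ℝ) (Δ : ℕ) {d e : ℕ} (ly : GNNLayer d e) (C : Set (Fin d → ℝ)) :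
    Prop :=
  Set.InjOn (fun p => ly.step σ p.1 p.2) (C ×ˢ boundedMultisets C Δ)

/-- Every layer is faithful on the states that can occur at its input, when the initial features lie
in `C`. The condition mentions no graph, so one network serves graphs in all universes. -/
def GNN.Faithful (σ : ℝ → ℝ) (Δ : ℕ) : {k d e : ℕ} → GNN k d e → Set (Fin d → ℝ) → Prop
  | _, _, _, .nil, _ => True
  | _, _, _, .cons first rest, C => first.Faithful σ Δ C ∧
      rest.Faithful σ Δ ((fun p => first.step σ p.1 p.2) '' (C ×ˢ boundedMultisets C Δ))

/-- With indicator vectors as messages, the aggregated message counts the neighbours in each state,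
so the update only has to be the identity on the finitely many inputs that can occur. -/
theorem GNNLayer.exists_faithful {σ : ℝ → ℝ} (hσ : Continuous σ)
    (hσ' : ¬ ∃ p : Polynomial ℝ, ∀ x, σ x = p.eval x) (Δ : ℕ) {d : ℕ} {C : Set (Fin d → ℝ)}
    (hC : C.Finite) : ∃ (e : ℕ) (ly : GNNLayer d e), ly.Faithful σ Δ C := by
  classical
  lift C to Finset (Fin d → ℝ) using hC
  let enum : Fin C.card ≃ C := C.equivFin.symm
  -- the message is the indicator vector of the neighbour's state
  obtain ⟨f₂, hf₂⟩ := MLP.exists_eqOn hσ hσ'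
    ((C.finite_toSet.prod C.finite_toSet).image fun p => Fin.append p.1 p.2)
    (fun z (i : Fin C.card) => if (fun j => z (Fin.natAdd d j)) = enum i then (1 : ℝ) else 0)
  have hmsg : ∀ c ∈ C, ∀ x ∈ C, f₂.eval σ (Fin.append c x) =
      fun i => if x = enum i then (1 : ℝ) else 0 := by
    intro c hc x hx
    rw [hf₂ ⟨(c, x), ⟨hc, hx⟩, rfl⟩]
    simp only [Fin.append_right]
  let counts : Multiset (Fin d → ℝ) → Fin C.card → ℝ := fun s i => s.count (enum i : Fin d → ℝ)
  have hsum : ∀ c ∈ C, ∀ s : Multiset (Fin d → ℝ), (∀ x ∈ s, x ∈ C) →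
      (s.map fun x => f₂.eval σ (Fin.append c x)).sum = counts s := by
    intro c hc s
    induction s using Multiset.induction_on with
    | empty => intro _; ext i; simp [counts]
    | cons x s ih =>
      intro hs
      rw [Multiset.map_cons, Multiset.sum_cons, ih fun y hy => hs y (Multiset.mem_cons_of_mem hy),
        hmsg c hc x (hs x (Multiset.mem_cons_self x s))]
      ext i
      by_cases hx : x = enum i
      · simp [counts, hx, add_comm]
      · simp [counts, hx, Multiset.count_cons_of_ne (Ne.symm hx)]
  obtain ⟨f₁, hf₁⟩ := MLP.exists_eqOn hσ hσ'
    ((C.finite_toSet.prod (finite_boundedMultisets C.finite_toSet Δ)).image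
      fun p => Fin.append p.1 (counts p.2)) id
  refine ⟨_, ⟨f₁, f₂⟩, ?_⟩
  have hstep : ∀ p ∈ (C : Set (Fin d → ℝ)) ×ˢ boundedMultisets (C : Set (Fin d → ℝ)) Δ,
      GNNLayer.step σ ⟨f₁, f₂⟩ p.1 p.2 = Fin.append p.1 (counts p.2) := by
    rintro ⟨c, s⟩ ⟨hc, hs⟩
    rw [GNNLayer.step, hsum c hc s hs.1]
    exact hf₁ ⟨(c, s), ⟨hc, hs⟩, rfl⟩
  intro p hp q hq hpq
  simp only [hstep p hp, hstep q hq] at hpq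
  have h1 : p.1 = q.1 := funext fun i => by
    simpa only [Fin.append_left] using congrFun hpq (Fin.castAdd _ i)
  have h2 : counts p.2 = counts q.2 := funext fun i => by
    simpa only [Fin.append_right] using congrFun hpq (Fin.natAdd _ i)
  refine Prod.ext h1 (Multiset.ext.2 fun x => ?_)
  by_cases hx : x ∈ C
  · have := congrFun h2 (enum.symm ⟨x, hx⟩)
    simpa [counts] using this
  · rw [Multiset.count_eq_zero_of_notMem fun h => hx (hp.2.1 x h),
      Multiset.count_eq_zero_of_notMem fun h => hx (hq.2.1 x h)]

theorem GNN.exists_faithful {σ : ℝ → ℝ} (hσ : Continuous σ)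
    (hσ' : ¬ ∃ p : Polynomial ℝ, ∀ x, σ x = p.eval x) (Δ k : ℕ) {d : ℕ} {C : Set (Fin d → ℝ)}
    (hC : C.Finite) : ∃ (e : ℕ) (M : GNN k d e), M.Faithful σ Δ C := by
  induction k generalizing d with
  | zero => exact ⟨d, .nil, trivial⟩
  | succ k ih =>
    obtain ⟨e, ly, hly⟩ := GNNLayer.exists_faithful hσ hσ' Δ hC
    obtain ⟨f, M, hM⟩ := ih
      ((hC.prod (finite_boundedMultisets hC Δ)).image fun p => ly.step σ p.1 p.2)
    exact ⟨f, .cons ly M, hly, hM⟩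

theorem Multiset.map_eq_map_of_imp {α β γ δ : Type*} {s : Multiset α} {t : Multiset β}
    {f : α → γ} {f' : β → γ} {g : α → δ} {g' : β → δ} (h : s.map f = t.map f')
    (himp : ∀ x ∈ s, ∀ y ∈ t, f x = f' y → g x = g' y) : s.map g = t.map g' := by
  rw [← Multiset.rel_eq, Multiset.rel_map] at h ⊢
  exact h.mono himp

section
variable {V : Type u} {W : Type w} [Fintype V] [Fintype W] {d e : ℕ}

/-- If new features determine the colours after one iteration, then `t` iterations on the new
features determine `t + 1` iterations on the old ones. -/
theorem wl_succ_eq_of_feat_imp {G : AttrGraph V d} {H : AttrGraph W d}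
    {g : V → (Fin e → ℝ)} {h : W → (Fin e → ℝ)}
    (himp : ∀ x y, g x = h y → wl G 1 x = wl H 1 y) (t : ℕ) (a : V) (b : W)
    (hab : wl ⟨G.graph, g⟩ t a = wl ⟨H.graph, h⟩ t b) : wl G (t + 1) a = wl H (t + 1) b := by
  induction t generalizing a b with
  | zero => exact himp a b hab
  | succ t ih =>
    obtain ⟨h1, h2⟩ := Prod.ext_iff.1 hab
    exact Prod.ext (ih a b h1)
      (Multiset.map_eq_map_of_imp h2 fun x _ y _ hxy => ih x y hxy)

open Classical in
theorem ncard_neighborSet_eq_card (G : SimpleGraph V) (v : V) :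
    (G.neighborSet v).ncard = (Finset.univ.filter fun x => G.Adj v x).card := by
  rw [← Set.ncard_coe_finset]
  congr 1
  ext x
  simp

open Classical in
theorem map_neighbors_mem_boundedMultisets {G : SimpleGraph V} {h : V → (Fin d → ℝ)}
    {C : Set (Fin d → ℝ)} {Δ : ℕ} (hh : ∀ x, h x ∈ C) {v : V}
    (hv : (G.neighborSet v).ncard ≤ Δ) :
    (Finset.univ.filter (fun x => G.Adj v x)).val.map h ∈ boundedMultisets C Δ := by
  rw [ncard_neighborSet_eq_card] at hv
  refine ⟨fun y hy => ?_, (Multiset.card_map _ _).trans_le hv⟩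
  obtain ⟨x, -, rfl⟩ := Multiset.mem_map.1 hy
  exact hh x

/-- A faithful network with `k` layers is at least as discriminative as `k` iterations of 1-WL. -/
theorem GNN.Faithful.wl_eq_of_run_eq {σ : ℝ → ℝ} {Δ k : ℕ} {M : GNN k d e}
    {C : Set (Fin d → ℝ)} (hM : M.Faithful σ Δ C) {G : AttrGraph V d} {H : AttrGraph W d}
    (hG : ∀ x, G.feat x ∈ C) (hH : ∀ x, H.feat x ∈ C)
    (hGΔ : ∀ x, (G.graph.neighborSet x).ncard ≤ Δ) (hHΔ : ∀ x, (H.graph.neighborSet x).ncard ≤ Δ)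
    {a : V} {b : W} (hab : M.run σ G.graph G.feat a = M.run σ H.graph H.feat b) :
    wl G k a = wl H k b := by
  induction M with
  | nil => exact hab
  | cons first rest ih =>
    have key : ∀ x y, first.apply σ G.graph G.feat x = first.apply σ H.graph H.feat y →
        wl G 1 x = wl H 1 y := by
      intro x y hxy
      rw [GNNLayer.apply_eq_step, GNNLayer.apply_eq_step] at hxy
      exact hM.1.eq_iff
        (x := (_, _)) ⟨hG x, map_neighbors_mem_boundedMultisets hG (hGΔ x)⟩
        (y := (_, _)) ⟨hH y, map_neighbors_mem_boundedMultisets hH (hHΔ y)⟩ |>.1 hxy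
    refine wl_succ_eq_of_feat_imp key _ a b (ih (G := ⟨G.graph, _⟩) (H := ⟨H.graph, _⟩) hM.2
      (fun x => ?_) (fun x => ?_) hGΔ hHΔ hab)
    · exact ⟨(_, _), ⟨hG x, map_neighbors_mem_boundedMultisets hG (hGΔ x)⟩,
        (GNNLayer.apply_eq_step σ first G.graph G.feat x).symm⟩
    · exact ⟨(_, _), ⟨hH x, map_neighbors_mem_boundedMultisets hH (hHΔ x)⟩,
        (GNNLayer.apply_eq_step σ first H.graph H.feat x).symm⟩

theorem wl_eq_of_le {G : AttrGraph V d} {H : AttrGraph W d} {s t : ℕ} (hst : s ≤ t) {a : V} {b : W}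
    (hab : wl G t a = wl H t b) : wl G s a = wl H s b := by
  induction t, hst using Nat.le_induction with
  | base => exact hab
  | succ t _ ih => exact ih (Prod.ext_iff.1 hab).1

end

/-! ### Colour refinement on hop neighbourhoods -/

section
variable {V : Type u} {W : Type w} [Fintype V] [Fintype W] {d e : ℕ}

theorem hopSubgraph_coe_adj {V : Type u} {G : SimpleGraph V} {L : ℕ} {a : V}
    (x y : (hopSubgraph G L a).verts) :
    (hopSubgraph G L a).coe.Adj x y ↔ G.Adj x y :=
  ⟨fun h => h.2.2, fun h => ⟨x.2, y.2, h⟩⟩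

theorem image_hopSubgraph_neighborSet {V : Type u} (G : SimpleGraph V) (L : ℕ) (a : V)
    (x : (hopSubgraph G L a).verts) :
    Subtype.val '' (hopSubgraph G L a).coe.neighborSet x =
      G.neighborSet x ∩ {y | G.edist a y ≤ L} := by
  ext y
  constructor
  · rintro ⟨y, hy, rfl⟩
    exact ⟨(hopSubgraph_coe_adj x y).1 hy, y.2⟩
  · rintro ⟨hy, hya⟩
    exact ⟨⟨y, hya⟩, (hopSubgraph_coe_adj x ⟨y, hya⟩).2 hy, rfl⟩

theorem ncard_hopSubgraph_neighborSet {V : Type u} (G : SimpleGraph V) (L : ℕ) (a : V)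
    (x : (hopSubgraph G L a).verts) :
    ((hopSubgraph G L a).coe.neighborSet x).ncard =
      (G.neighborSet x ∩ {y | G.edist a y ≤ L}).ncard := by
  rw [← image_hopSubgraph_neighborSet, Set.ncard_image_of_injective _ Subtype.val_injective]

theorem ncard_hopSubgraph_neighborSet_le (G : SimpleGraph V) (L : ℕ) (a : V)
    (x : (hopSubgraph G L a).verts) :
    ((hopSubgraph G L a).coe.neighborSet x).ncard ≤ (G.neighborSet x).ncard := by
  rw [ncard_hopSubgraph_neighborSet]
  exact Set.ncard_le_ncard Set.inter_subset_left

open Classical in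
/-- Nodes at distance at most `i` from the root keep all information that reaches them in at most
`L - i` rounds. -/
theorem wl_restrict_hopSubgraph (G : AttrGraph V d) (L : ℕ) (a : V)
    [Fintype (hopSubgraph G.graph L a).verts] (t i : ℕ) (hit : i + t ≤ L)
    (x : (hopSubgraph G.graph L a).verts) (hx : G.graph.edist a x ≤ i) :
    wl (G.restrict (hopSubgraph G.graph L a)) t x = wl G t x := by
  induction t generalizing i x with
  | zero => rfl
  | succ t ih =>
    have hstep : ∀ y, G.graph.Adj x y → G.graph.edist a y ≤ (i + 1 : ℕ) := by
      intro y hy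
      refine SimpleGraph.edist_triangle.trans ((add_le_add hx ?_).trans_eq (Nat.cast_add i 1).symm)
      simpa using SimpleGraph.edist_le hy.toWalk
    refine Prod.ext (ih i (by omega) x hx) ?_
    have hmap : (Finset.univ.filter fun y => G.graph.Adj x y) =
        (Finset.univ.filter fun y => (hopSubgraph G.graph L a).coe.Adj x y).map
          (Function.Embedding.subtype _) := by
      ext y
      simp only [Finset.mem_filter, Finset.mem_univ, true_and, Finset.mem_map,
        Function.Embedding.subtype_apply]
      constructor
      · intro hy
        have hya : G.graph.edist a y ≤ L := (hstep y hy).trans (by exact_mod_cast by omega)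
        exact ⟨⟨y, hya⟩, (hopSubgraph_coe_adj x ⟨y, hya⟩).2 hy, rfl⟩
      · rintro ⟨y, hy, rfl⟩
        exact (hopSubgraph_coe_adj x y).1 hy
    change Multiset.map _ _ = Multiset.map _ _
    rw [hmap, Finset.map_val, Multiset.map_map]
    refine Multiset.map_congr rfl fun y hy => ?_
    refine ih (i + 1) (by omega) y (hstep y ?_)
    exact (hopSubgraph_coe_adj x y).1 (Finset.mem_filter.1 hy).2

open Classical in
/-- A faithful network run on hop neighbourhoods separates whatever 1-WL on these neighbourhoods
separates within as many iterations as there are layers. -/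
theorem GNN.Faithful.shadow_ne {σ : ℝ → ℝ} {Δ k L : ℕ} {M : GNN k d e}
    {C : Set (Fin d → ℝ)} (hM : M.Faithful σ Δ C) {G : AttrGraph V d} {H : AttrGraph W d}
    (hG : ∀ x, G.feat x ∈ C) (hH : ∀ x, H.feat x ∈ C)
    (hGΔ : ∀ x, (G.graph.neighborSet x).ncard ≤ Δ) (hHΔ : ∀ x, (H.graph.neighborSet x).ncard ≤ Δ)
    {a : V} {b : W} {t : ℕ} (ht : t ≤ k)
    (hab : wl (G.restrict (hopSubgraph G.graph L a)) t ⟨a, hopSubgraph_mem G.graph L a⟩ ≠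
      wl (H.restrict (hopSubgraph H.graph L b)) t ⟨b, hopSubgraph_mem H.graph L b⟩) :
    shadow σ M G (hopExtractor L G.graph) a ≠ shadow σ M H (hopExtractor L H.graph) b := by
  intro heq
  refine hab (wl_eq_of_le ht (hM.wl_eq_of_run_eq
    (G := G.restrict (hopSubgraph G.graph L a)) (H := H.restrict (hopSubgraph H.graph L b))
    (fun x => hG x) (fun x => hH x)
    (fun x => (ncard_hopSubgraph_neighborSet_le G.graph L a x).trans (hGΔ x))
    (fun x => (ncard_hopSubgraph_neighborSet_le H.graph L b x).trans (hHΔ x)) ?_))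
  exact heq

/-- The colour, after `t` iterations, of every node of an `r`-regular graph whose nodes all have the
feature `c`. -/
def regularColor {α : Type} (c : α) (r : ℕ) : (t : ℕ) → WLColor α t
  | 0 => c
  | t + 1 => (regularColor c r t, Multiset.replicate r (regularColor c r t))

theorem wl_eq_regularColor {G : AttrGraph V d} {c : Fin d → ℝ} {r : ℕ} (hc : ∀ x, G.feat x = c)
    (hr : ∀ x, (G.graph.neighborSet x).ncard = r) (t : ℕ) (x : V) :
    wl G t x = regularColor c r t := by
  classical
  induction t generalizing x with
  | zero => exact hc x
  | succ t ih =>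
    refine Prod.ext (ih x) ?_
    change Multiset.map _ _ = Multiset.replicate _ _
    rw [Multiset.map_congr rfl fun y _ => ih y, Multiset.map_const', ← hr x,
      ncard_neighborSet_eq_card]
    rfl

theorem ncard_neighborSet_eq_of_wl_eq {G : AttrGraph V d} {H : AttrGraph W d} {t : ℕ} {a : V}
    {b : W} (hab : wl G (t + 1) a = wl H (t + 1) b) :
    (G.graph.neighborSet a).ncard = (H.graph.neighborSet b).ncard := by
  rw [ncard_neighborSet_eq_card, ncard_neighborSet_eq_card]
  exact (Multiset.card_map _ _).symm.trans
    ((congrArg Multiset.card (Prod.ext_iff.1 hab).2).trans (Multiset.card_map _ _))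

theorem exists_adj_wl_eq {G : AttrGraph V d} {H : AttrGraph W d} {t : ℕ} {a x : V} {b : W}
    (hab : wl G (t + 1) a = wl H (t + 1) b) (hx : G.graph.Adj a x) :
    ∃ y, H.graph.Adj b y ∧ wl G t x = wl H t y := by
  classical
  have h := (Prod.ext_iff.1 hab).2
  have hmem : wl G t x ∈ (wl G (t + 1) a).2 :=
    Multiset.mem_map_of_mem _ (Finset.mem_filter.2 ⟨Finset.mem_univ x, hx⟩)
  rw [h] at hmem
  obtain ⟨y, hy, hxy⟩ := Multiset.mem_map.1 hmem
  exact ⟨y, (Finset.mem_filter.1 hy).2, hxy.symm⟩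

/-- A node coloured after `t + 1` iterations as in a regular graph sees only nodes of the right
degree within `t` steps. -/
theorem ncard_neighborSet_eq_of_walk {G : AttrGraph V d} {H : AttrGraph W d} {r : ℕ}
    (hr : ∀ x, (H.graph.neighborSet x).ncard = r) {a x : V} (p : G.graph.Walk a x) {t : ℕ}
    (hp : p.length ≤ t) {b : W} (hab : wl G (t + 1) a = wl H (t + 1) b) :
    (G.graph.neighborSet x).ncard = r := by
  induction p generalizing t b with
  | nil => rw [ncard_neighborSet_eq_of_wl_eq hab, hr]
  | cons h p ih =>
    obtain ⟨t, rfl⟩ : ∃ s, t = s + 1 := ⟨t - 1, by simp at hp; omega⟩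
    obtain ⟨y, -, hy⟩ := exists_adj_wl_eq hab h
    exact ih (by simpa using hp) hy

/-- In a regular graph, colour refinement on hop neighbourhoods distinguishes a node all of whose
component lies within `L` hops from one that reaches a node farther away. -/
theorem wl_restrict_hopSubgraph_ne_of_regular {G : AttrGraph V d} {r L : ℕ}
    (hr : ∀ x, (G.graph.neighborSet x).ncard = r) {a b : V}
    (ha : ∀ x, G.graph.Reachable a x → G.graph.edist a x ≤ L)
    (hb : ∃ x, G.graph.Reachable b x ∧ L < G.graph.edist b x)
    [Fintype (hopSubgraph G.graph L a).verts] [Fintype (hopSubgraph G.graph L b).verts] :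
    wl (G.restrict (hopSubgraph G.graph L a)) (L + 1) ⟨a, hopSubgraph_mem G.graph L a⟩ ≠
      wl (G.restrict (hopSubgraph G.graph L b)) (L + 1) ⟨b, hopSubgraph_mem G.graph L b⟩ := by
  intro heq
  have hra : ∀ x, ((hopSubgraph G.graph L a).coe.neighborSet x).ncard = r := by
    intro x
    rw [ncard_hopSubgraph_neighborSet, ← hr x, Set.inter_eq_left.2]
    intro y hy
    have hax : G.graph.Reachable a x :=
      SimpleGraph.reachable_of_edist_ne_top (ne_top_of_le_ne_top (ENat.natCast_ne_top L) x.2)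
    exact ha y (hax.trans (SimpleGraph.Adj.reachable hy))
  -- every node of the neighbourhood of `b` has its full degree, so no edge leaves it
  have hclosed : ∀ x y, G.graph.edist b x ≤ L → G.graph.Adj x y → G.graph.edist b y ≤ L := by
    intro x y hx hxy
    obtain ⟨p, hp⟩ := hopSubgraph_walk G.graph L b (hopSubgraph_mem G.graph L b) ⟨x, hx⟩
    have h1 := ncard_neighborSet_eq_of_walk (G := G.restrict (hopSubgraph G.graph L b))
      (H := G.restrict (hopSubgraph G.graph L a)) hra p hp heq.symm
    have h2 := ncard_hopSubgraph_neighborSet G.graph L b ⟨x, hx⟩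
    have h3 : G.graph.neighborSet x ∩ {y | G.graph.edist b y ≤ L} = G.graph.neighborSet x :=
      Set.eq_of_subset_of_ncard_le Set.inter_subset_left (by rw [← h2, hr x]; exact h1.ge)
    exact (h3.ge hxy).2
  obtain ⟨x, ⟨p⟩, hx⟩ := hb
  refine hx.not_ge ?_
  have hwalk : ∀ {u v} (_ : G.graph.Walk u v), G.graph.edist b u ≤ L → G.graph.edist b v ≤ L := by
    intro u v p
    induction p with
    | nil => exact id
    | cons h _ ih => exact fun hu => ih (hclosed _ _ hu h)
  exact hwalk p (by simp)

end

/-! ### A triangle and a long cycle, and the chorded octagon -/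

/-- The disjoint union of a triangle and a cycle of length `2 * L + 3`. Both components are
`2`-regular; for `L ≥ 1` the triangle lies within `L` hops of each of its nodes, while the longer
cycle has nodes at distance `L + 1`. -/
def triangleSumCycle (L : ℕ) : SimpleGraph (Fin 3 ⊕ Fin (2 * L + 3)) :=
  (⊤ : SimpleGraph (Fin 3)) ⊕g SimpleGraph.cycleGraph (2 * L + 3)

theorem ncard_neighborSet_triangleSumCycle (L : ℕ) (x : Fin 3 ⊕ Fin (2 * L + 3)) :
    ((triangleSumCycle L).neighborSet x).ncard = 2 := by
  rcases x with x | x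
  · have h : (triangleSumCycle L).neighborSet (.inl x) =
        Sum.inl '' ((⊤ : SimpleGraph (Fin 3)).neighborSet x) := by
      ext (y | y) <;> simp [triangleSumCycle, eq_comm]
    rw [h, Set.ncard_image_of_injective _ Sum.inl_injective, Set.ncard_eq_toFinset_card',
      ← SimpleGraph.neighborFinset_def, SimpleGraph.card_neighborFinset_eq_degree]
    simp
  · have h : (triangleSumCycle L).neighborSet (.inr x) =
        Sum.inr '' ((SimpleGraph.cycleGraph (2 * L + 3)).neighborSet x) := by
      ext (y | y) <;> simp [triangleSumCycle]
    rw [h, Set.ncard_image_of_injective _ Sum.inr_injective, Set.ncard_eq_toFinset_card',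
      ← SimpleGraph.neighborFinset_def, SimpleGraph.card_neighborFinset_eq_degree]
    exact SimpleGraph.cycleGraph_degree_three_le

theorem SimpleGraph.Walk.le_add_length_of_adj {V : Type u} {G : SimpleGraph V} {f : V → ℕ}
    (hf : ∀ x y, G.Adj x y → f y ≤ f x + 1) {a b : V} (p : G.Walk a b) :
    f b ≤ f a + p.length := by
  induction p with
  | nil => simp
  | cons h p ih =>
    have := hf _ _ h
    rw [SimpleGraph.Walk.length_cons]
    omega

theorem edist_triangleSumCycle_inl_le {L : ℕ} (hL : 1 ≤ L) {x : Fin 3 ⊕ Fin (2 * L + 3)}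
    (hx : (triangleSumCycle L).Reachable (.inl 0) x) :
    (triangleSumCycle L).edist (.inl 0) x ≤ L := by
  rcases x with x | x
  · rcases eq_or_ne 0 x with rfl | h
    · simp
    · have hadj : (triangleSumCycle L).Adj (.inl 0) (.inl x) := by simpa [triangleSumCycle] using h
      refine (SimpleGraph.edist_le hadj.toWalk).trans ?_
      simpa using hL
  · exact absurd hx (SimpleGraph.not_reachable_sum_inl_inr _ _)

theorem lt_edist_triangleSumCycle_inr (L : ℕ) :
    (L : ℕ∞) < (triangleSumCycle L).edist (.inr 0) (.inr ⟨L + 1, by omega⟩) := by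
  -- the distance from the node `0` along the shorter arc is `1`-Lipschitz
  let f : Fin 3 ⊕ Fin (2 * L + 3) → ℕ := Sum.elim 0 fun i => min i (2 * L + 3 - i)
  have hf : ∀ x y, (triangleSumCycle L).Adj x y → f y ≤ f x + 1 := by
    rintro (x | x) (y | y) h
    · simp [f]
    · simp [triangleSumCycle] at h
    · simp [triangleSumCycle] at h
    · have h' : (SimpleGraph.cycleGraph (2 * L + 3)).Adj x y := by
        simpa [triangleSumCycle] using h
      rw [SimpleGraph.cycleGraph_adj'] at h'
      have hx := x.2
      have hy := y.2
      simp only [f, Sum.elim_inr]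
      rcases h' with h' | h' <;> rcases lt_or_ge x.1 y.1 with hlt | hge <;>
        grind [Fin.coe_sub_iff_le, Fin.coe_sub_iff_lt]
  by_contra! hle
  obtain ⟨p, hp⟩ := SimpleGraph.exists_walk_of_edist_ne_top
    (ne_top_of_le_ne_top (ENat.natCast_ne_top L) hle)
  have h1 := p.le_add_length_of_adj hf
  rw [← hp] at hle
  have h2 : p.length ≤ L := by exact_mod_cast hle
  simp [f] at h1
  omega

theorem reachable_triangleSumCycle_inr (L : ℕ) (x : Fin (2 * L + 3)) :
    (triangleSumCycle L).Reachable (.inr 0) (.inr x) :=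
  ((SimpleGraph.cycleGraph_preconnected (n := 2 * L + 3)) 0 x).map
    (SimpleGraph.Embedding.sumInr (G := (⊤ : SimpleGraph (Fin 3)))).toHom

instance : DecidableRel chordedOctagon.Adj := fun x y =>
  decidable_of_iff ((SimpleGraph.cycleGraph 8).Adj x y ∨
    (s(x, y) ∈ ({s(1, 5), s(0, 2), s(4, 7), s(3, 6)} : Finset (Sym2 (Fin 8))) ∧ x ≠ y)) (by
      simp [chordedOctagon])

theorem chordedOctagon_connected : chordedOctagon.Connected :=
  SimpleGraph.cycleGraph_connected.mono le_sup_left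

theorem ncard_neighborSet_chordedOctagon (x : Fin 8) :
    (chordedOctagon.neighborSet x).ncard = 3 := by
  rw [Set.ncard_eq_toFinset_card', ← SimpleGraph.neighborFinset_def,
    SimpleGraph.card_neighborFinset_eq_degree]
  revert x
  decide

theorem chordedOctagon_edist_le_one {x y : Fin 8} :
    chordedOctagon.edist x y ≤ 1 ↔ x = y ∨ chordedOctagon.Adj x y := by
  constructor
  · intro h
    obtain ⟨p, hp⟩ := SimpleGraph.exists_walk_of_edist_ne_top (ne_top_of_le_ne_top ENat.one_ne_top h)
    rw [← hp] at h
    have hle : p.length ≤ 1 := by exact_mod_cast h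
    rcases Nat.le_one_iff_eq_zero_or_eq_one.1 hle with h0 | h1
    · exact .inl (SimpleGraph.Walk.eq_of_length_eq_zero h0)
    · exact .inr (SimpleGraph.Walk.adj_of_length_eq_one h1)
  · rintro (rfl | h)
    · simp
    · simpa using SimpleGraph.edist_le h.toWalk

/-- The neighbours `0` and `2` of `1` are adjacent, while no two neighbours of `3` are: within one
hop, `1` has a neighbour of degree `2`, and all neighbours of `3` have degree `1`. -/
theorem wl_restrict_hopSubgraph_chordedOctagon_ne {d : ℕ} (c : Fin d → ℝ)
    [Fintype (hopSubgraph chordedOctagon 1 1).verts]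
    [Fintype (hopSubgraph chordedOctagon 1 3).verts] :
    wl ((AttrGraph.const chordedOctagon c).restrict (hopSubgraph chordedOctagon 1 1)) 2
        ⟨1, hopSubgraph_mem chordedOctagon 1 1⟩ ≠
      wl ((AttrGraph.const chordedOctagon c).restrict (hopSubgraph chordedOctagon 1 3)) 2
        ⟨3, hopSubgraph_mem chordedOctagon 1 3⟩ := by
  intro heq
  have h0 : (0 : Fin 8) ∈ (hopSubgraph chordedOctagon 1 1).verts :=
    chordedOctagon_edist_le_one.2 (by decide)
  -- the neighbour `0` of `1` has two neighbours in the neighbourhood of `1`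
  obtain ⟨y, hy, hwl⟩ := exists_adj_wl_eq (x := ⟨0, h0⟩) heq
    ((hopSubgraph_coe_adj _ _).2 (by change chordedOctagon.Adj 1 0; decide))
  have hcard := ncard_neighborSet_eq_of_wl_eq hwl
  have hy' : chordedOctagon.Adj 3 y := (hopSubgraph_coe_adj _ _).1 hy
  change ((hopSubgraph chordedOctagon 1 1).coe.neighborSet ⟨0, h0⟩).ncard =
    ((hopSubgraph chordedOctagon 1 3).coe.neighborSet y).ncard at hcard
  rw [ncard_hopSubgraph_neighborSet, ncard_hopSubgraph_neighborSet] at hcard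
  have h1 : ({1, 2} : Set (Fin 8)) ⊆
      chordedOctagon.neighborSet 0 ∩ {z | chordedOctagon.edist 1 z ≤ (1 : ℕ)} := by
    rintro z (rfl | rfl) <;>
      exact ⟨by change chordedOctagon.Adj _ _; decide, chordedOctagon_edist_le_one.2 (by decide)⟩
  have h2 : chordedOctagon.neighborSet y ∩ {z | chordedOctagon.edist 3 z ≤ (1 : ℕ)} ⊆ {3} := by
    rintro z ⟨hz, hz'⟩
    have key : ∀ y z : Fin 8, chordedOctagon.Adj 3 y → chordedOctagon.Adj y z →
      (3 = z ∨ chordedOctagon.Adj 3 z) → z = 3 := by decide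
    exact key y z hy' hz (chordedOctagon_edist_le_one.1 hz')
  have h3 := Set.ncard_le_ncard h1
  have h4 := Set.ncard_le_ncard h2
  rw [Set.ncard_pair (by decide)] at h3
  rw [Set.ncard_singleton] at h4
  exact absurd (h3.trans (hcard.trans_le h4)) (by norm_num)

theorem theorem3 (σ : ℝ → ℝ) (hσ : Continuous σ)
    (hσ' : ¬ ∃ p : Polynomial ℝ, ∀ x, σ x = p.eval x) :
    (∀ (d : ℕ) (X : Set (Fin d → ℝ)), X.Finite → ∀ Δ L L' : ℕ, L < L' →
      ∃ (e : ℕ) (M : GNN L' d e),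
        -- whatever 1-WL separates within `L` iterations, the decoupled GNN separates
        (∀ (V : Type u) (W : Type w) [Fintype V] [Fintype W]
          (G : AttrGraph V d) (H : AttrGraph W d),
          (∀ x, G.feat x ∈ X) → (∀ x, H.feat x ∈ X) →
          (∀ x, (G.graph.neighborSet x).ncard ≤ Δ) → (∀ x, (H.graph.neighborSet x).ncard ≤ Δ) →
          ∀ (a : V) (b : W), (∃ t ≤ L, wl G t a ≠ wl H t b) →
            shadow σ M G (hopExtractor L G.graph) a ≠
              shadow σ M H (hopExtractor L H.graph) b) ∧
        -- it separates nodes that 1-WL never separates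
        (1 ≤ L → ∃ (V : Type) (_ : Fintype V) (G : SimpleGraph V) (a b : V),
          ∀ c ∈ X, (∀ t, wl (AttrGraph.const G c) t a = wl (AttrGraph.const G c) t b) ∧
            shadow σ M (AttrGraph.const G c) (hopExtractor L G) a ≠
              shadow σ M (AttrGraph.const G c) (hopExtractor L G) b) ∧
        -- for 1-hop scopes, two nodes of an explicit graph are an example
        (L = 1 → ∀ c ∈ X,
          shadow σ M (AttrGraph.const chordedOctagon c) (hopExtractor L chordedOctagon) 1 ≠
            shadow σ M (AttrGraph.const chordedOctagon c) (hopExtractor L chordedOctagon) 3)) ∧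
    chordedOctagon.Connected ∧ (∀ x, (chordedOctagon.neighborSet x).ncard = 3) ∧
    (∀ (d : ℕ) (c : Fin d → ℝ) (t : ℕ),
      wl (AttrGraph.const chordedOctagon c) t 1 = wl (AttrGraph.const chordedOctagon c) t 3) := by
  refine ⟨fun d X hX Δ L L' hLL' => ?_, chordedOctagon_connected, ncard_neighborSet_chordedOctagon,
    fun d c t => ?_⟩
  · classical
    -- the two examples have maximum degree at most `3`
    obtain ⟨e, M, hM⟩ := GNN.exists_faithful hσ hσ' (max Δ 3) L' hX
    refine ⟨e, M, ?_, fun hL => ?_, ?_⟩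
    · rintro V W _ _ G H hG hH hGΔ hHΔ a b ⟨t, ht, hab⟩
      refine hM.shadow_ne hG hH (fun x => (hGΔ x).trans (le_max_left _ _))
        (fun x => (hHΔ x).trans (le_max_left _ _)) (ht.trans hLL'.le) ?_
      rwa [wl_restrict_hopSubgraph G L a t 0 (by omega) _ (by simp),
        wl_restrict_hopSubgraph H L b t 0 (by omega) _ (by simp)]
    · refine ⟨_, inferInstance, triangleSumCycle L, .inl 0, .inr 0, fun c hc => ⟨fun t => ?_, ?_⟩⟩
      · rw [wl_eq_regularColor (c := c) (fun _ => rfl) (ncard_neighborSet_triangleSumCycle L),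
          wl_eq_regularColor (c := c) (fun _ => rfl) (ncard_neighborSet_triangleSumCycle L)]
      · have hdeg := fun x => (ncard_neighborSet_triangleSumCycle L x).trans_le
          ((by norm_num : 2 ≤ 3).trans (le_max_right Δ 3))
        exact hM.shadow_ne (fun _ => hc) (fun _ => hc) hdeg hdeg (t := L + 1) hLL'
          (wl_restrict_hopSubgraph_ne_of_regular (G := AttrGraph.const (triangleSumCycle L) c)
            (ncard_neighborSet_triangleSumCycle L)
            (fun _ => edist_triangleSumCycle_inl_le hL)
            ⟨_, reachable_triangleSumCycle_inr L _, lt_edist_triangleSumCycle_inr L⟩)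
    · rintro rfl c hc
      have hdeg := fun x => (ncard_neighborSet_chordedOctagon x).trans_le (le_max_right Δ 3)
      exact hM.shadow_ne (L := 1) (G := AttrGraph.const chordedOctagon c)
        (H := AttrGraph.const chordedOctagon c) (a := (1 : Fin 8)) (b := (3 : Fin 8))
        (fun _ => hc) (fun _ => hc) hdeg hdeg (t := 2) hLL'
        (wl_restrict_hopSubgraph_chordedOctagon_ne c)
  · rw [wl_eq_regularColor (c := c) (fun _ => rfl) ncard_neighborSet_chordedOctagon,
      wl_eq_regularColor (c := c) (fun _ => rfl) ncard_neighborSet_chordedOctagon]
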